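/- Let $m,l$ be integers with $0<m\le l$, let $(X,d)$ be a locally compact metric space, let $\Lambda\subset\mathbb{R}^l$ be open and bounded, and let $\Pi\colon X\times\Lambda\to\mathbb{R}^m$ be continuous; write $\Pi_\lambda(x):=\Pi(x,\lambda)$ and, for $x\neq x'$ in $X$, $T_{xx'}(\lambda):=\dfrac{\Pi_\lambda(x)-\Pi_\lambda(x')}{d(x,x')}$. Assume that the family $(\Pi_\lambda)_{\lambda\in\Lambda}$ is transversal, that is: (H.1) for every $x\in X$ the map $\lambda\mapsto\Pi_\lambda(x)$ belongs to $C^2(\Lambda;\mathbb{R}^m)$, and $\sup_{(\lambda,x)\in\Lambda\times X}\|D^j_\lambda\Pi_\lambda(x)\|<\infty$ for $j=1,2$; (H.2) there is a constant $C'>0$ such that, for all $\lambda\in\Lambda$ and all $x\neq x'$ in $X$, $|T_{xx'}(\lambda)|\le C'$ implies $|\mathrm{J}_\lambda T_{xx'}(\lambda)|\ge C'$, where $\mathrm{J}_\lambda T:=\sqrt{\det\big(D_\lambda T\,(D_\lambda T)^{t}\big)}$; (H.3) there is a constant $C''>0$ such that $\|D_\lambda T_{xx'}(\lambda)\|\le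 C''$ and $\|D^2_\lambda T_{xx'}(\lambda)\|\le C''$ for all $\lambda\in\Lambda$ and all $x\neq x'$ in $X$. Let $\mu$ be a finite Borel measure on $X$. For $\lambda\in\Lambda$ let $\Pi_\lambda\mu$ be the push-forward of $\mu$ under $\Pi_\lambda$, and let $(\Pi_\lambda\mu)^a$ be its absolutely continuous part with respect to the Hausdorff measure $\mathcal{H}^m$ on $\mathbb{R}^m$. Then, for every Borel set $\Sigma\subset\Lambda$, at least one of the following two conditions holds: (1) for $\mathcal{L}^l$-a.e. $\lambda\in\Sigma$, the map $\Pi_\lambda\colon X\to\mathbb{R}^m$ is injective on a set of full $\mu$-measure (which may depend on $\lambda$); (2) $\mathcal{L}^l\big(\{\lambda\in\Sigma : (\Pi_\lambda\mu)^a\neq 0\}\big)>0$. -/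

import Mathlib

open MeasureTheory Set
open scoped ENNReal

noncomputable section

/-- The `m`-dimensional Jacobian `√(det (L Lᵗ))` of a linear map `L : ℝˡ → ℝᵐ`, `m ≤ l`. -/
def jacobian {l m : ℕ}
    (L : EuclideanSpace ℝ (Fin l) →L[ℝ] EuclideanSpace ℝ (Fin m)) : ℝ :=
  Real.sqrt ((L.comp (ContinuousLinearMap.adjoint L)).det)

/-- The difference quotient `T_{xx'}(p) = (F_p(x) - F_p(x')) / d(x, x')` in the space variable
(meant for `x ≠ x'`). -/
def diffQuot {X : Type*} [MetricSpace X] {l m : ℕ}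
    (F : X → EuclideanSpace ℝ (Fin l) → EuclideanSpace ℝ (Fin m)) (x x' : X)
    (p : EuclideanSpace ℝ (Fin l)) : EuclideanSpace ℝ (Fin m) :=
  (dist x x')⁻¹ • (F x p - F x' p)

/-- `(F · p)_{p ∈ Λ}` is a transversal family of maps `X → ℝᵐ`. The set `Λ` is meant to be open,
so that derivatives in `p` at points of `Λ` only see the values of `F` on `X × Λ`. -/
structure IsTransversalFamily {X : Type*} [MetricSpace X] {l m : ℕ}
    (Λ : Set (EuclideanSpace ℝ (Fin l)))
    (F : X → EuclideanSpace ℝ (Fin l) → EuclideanSpace ℝ (Fin m)) : Prop where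
  /-- joint continuity on `X × Λ` -/
  continuousOn : ContinuousOn (fun q : X × EuclideanSpace ℝ (Fin l) => F q.1 q.2) (univ ×ˢ Λ)
  /-- `p ↦ F_p(x)` is of class `C²` on `Λ` -/
  contDiffOn : ∀ x : X, ContDiffOn ℝ 2 (F x) Λ
  /-- the first and second parameter derivatives are bounded on `X × Λ` -/
  bounded_deriv : ∃ C : ℝ, ∀ x : X, ∀ p ∈ Λ,
    ‖iteratedFDeriv ℝ 1 (F x) p‖ ≤ C ∧ ‖iteratedFDeriv ℝ 2 (F x) p‖ ≤ C
  /-- transversality -/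
  transversal : ∃ C : ℝ, 0 < C ∧ ∀ p ∈ Λ, ∀ x x' : X, x ≠ x' →
    ‖diffQuot F x x' p‖ ≤ C → C ≤ |jacobian (fderiv ℝ (diffQuot F x x') p)|
  /-- the first and second parameter derivatives of the difference quotients are bounded -/
  bounded_diffQuot : ∃ C : ℝ, 0 < C ∧ ∀ p ∈ Λ, ∀ x x' : X, x ≠ x' →
    ‖iteratedFDeriv ℝ 1 (diffQuot F x x') p‖ ≤ C ∧
      ‖iteratedFDeriv ℝ 2 (diffQuot F x x') p‖ ≤ C

/-- The absolutely continuous part, with respect to the `m`-dimensional Hausdorff measure, of a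
measure on `ℝᵐ` (from its Lebesgue decomposition, which exists for every finite measure). -/
def acPart {m : ℕ} (ν : Measure (EuclideanSpace ℝ (Fin m))) :
    Measure (EuclideanSpace ℝ (Fin m)) :=
  (Measure.hausdorffMeasure (m : ℝ)).withDensity
    (ν.rnDeriv (Measure.hausdorffMeasure (m : ℝ)))

end

/-! Suppose (2) fails, so that the image of `μ` is singular for a.e. parameter in `S`. Let `A`, `B`
be at positive distance. Transversality makes the parameters near `p₀` with `‖F x p - F x' p‖ ≤ δ` a
set of measure `O(δ ^ m)`, uniformly in `x ∈ A`, `x' ∈ B` (`exists_volume_close_le`). Integrating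
over `A` and `B`, Fubini and Fatou show that for a.e. `p` the image of `μ` restricted to `B` has
finite lower density at `F x p` for a.e. `x ∈ A` (`exists_ae_liminf_lt_top`). A singular measure has
infinite density at almost all of its own points, so the infinite-density set separates the images
of the two restrictions (`ae_exists_separating`). Countably many pairs of balls separate all pairs
of distinct points of `X`; discarding the corresponding null sets leaves a set on which `F · p` is
injective. -/

/-! ### Volume of sublevel sets of nearly linear maps -/

open Filter Topology Metric in
/-- The intersection of a ball with a tube of radius `ε` around the kernel of a surjective linear
map onto an `m`-dimensional space has volume `O(ε ^ m)`. -/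
theorem exists_measure_tube_le {V W : Type*}
    [NormedAddCommGroup V] [NormedSpace ℝ V] [FiniteDimensional ℝ V] [MeasurableSpace V]
    [BorelSpace V] [NormedAddCommGroup W] [NormedSpace ℝ W] [FiniteDimensional ℝ W]
    (κ : Measure V) [κ.IsAddHaarMeasure] (L : V →L[ℝ] W) (hL : Function.Surjective L) (R : ℝ) :
    ∃ K : ℝ≥0∞, K ≠ ∞ ∧ ∀ ε : ℝ, 0 < ε →
      κ {z | z ∈ closedBall 0 R ∧ ‖L z‖ ≤ ε} ≤ K * ENNReal.ofReal (ε ^ Module.finrank ℝ W) := by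
  borelize W
  obtain ⟨g, hg⟩ := L.toLinearMap.exists_rightInverse_of_surjective (LinearMap.range_eq_top.2 hL)
  let M : W →L[ℝ] V := LinearMap.toContinuousLinearMap g
  have hM : Function.RightInverse M L := fun w => LinearMap.congr_fun hg w
  -- `Ψ` identifies `V` with `W × ker L`; the tube lands in a ball of radius `ε` times a fixed ball.
  let Ψ := ContinuousLinearEquiv.equivOfRightInverse L M hM
  borelize ↥L.ker
  let κW : Measure W := Measure.addHaar
  let κN : Measure L.ker := Measure.addHaar
  have : (κ.map Ψ).IsAddHaarMeasure := Ψ.isAddHaarMeasure_map κ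
  have hsmul := Measure.isAddLeftInvariant_eq_smul (κ.map Ψ) (κW.prod κN)
  set c := (κ.map Ψ).addHaarScalarFactor (κW.prod κN)
  obtain ⟨R', hR'⟩ : ∃ R', ∀ z ∈ closedBall (0 : V) R, ‖(Ψ z).2‖ ≤ R' := by
    obtain ⟨R', h⟩ := (((isCompact_closedBall (0 : V) R).image
      (continuous_snd.comp Ψ.continuous))).isBounded.exists_norm_le
    exact ⟨R', fun z hz => h _ ⟨z, hz, rfl⟩⟩
  refine ⟨c * (κW (ball 0 1) * κN (closedBall 0 R')), 
    ENNReal.mul_ne_top ENNReal.coe_ne_top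
      (ENNReal.mul_ne_top measure_ball_lt_top.ne measure_closedBall_lt_top.ne), fun ε hε => ?_⟩
  calc κ {z | z ∈ closedBall 0 R ∧ ‖L z‖ ≤ ε}
      ≤ κ (Ψ ⁻¹' (closedBall 0 ε ×ˢ closedBall 0 R')) := by
        refine measure_mono fun z hz => ⟨?_, ?_⟩
        · simpa [Ψ] using hz.2
        · simpa using hR' z hz.1
    _ = (κ.map Ψ) (closedBall 0 ε ×ˢ closedBall 0 R') :=
        (Measure.map_apply Ψ.continuous.measurable
          (measurableSet_closedBall.prod measurableSet_closedBall)).symm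
    _ = c * (κW (closedBall 0 ε) * κN (closedBall 0 R')) := by
        rw [hsmul, Measure.smul_apply, Measure.prod_prod]; rfl
    _ = _ := by
        rw [Measure.addHaar_closedBall _ _ hε.le]; ring

open Filter Topology Metric in
/-- Uniform version of `exists_measure_tube_le` for maps close to a surjective linear map. -/
theorem exists_measure_sublevel_le {V W : Type*}
    [NormedAddCommGroup V] [NormedSpace ℝ V] [FiniteDimensional ℝ V] [MeasurableSpace V]
    [BorelSpace V] [NormedAddCommGroup W] [NormedSpace ℝ W] [FiniteDimensional ℝ W]
    (κ : Measure V) [κ.IsAddHaarMeasure] (L : V →L[ℝ] W) (hL : Function.Surjective L) (R C : ℝ) :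
    ∃ η : ℝ, 0 < η ∧ ∃ K : ℝ≥0∞, K ≠ ∞ ∧ ∀ T : V → W, ∀ Q ⊆ closedBall (0 : V) R,
      (∀ x ∈ Q, ∀ y ∈ Q, ‖T x - T y - L (x - y)‖ ≤ η * ‖x - y‖) → ∀ ε : ℝ, 0 < ε → ε ≤ C →
      κ {p ∈ Q | ‖T p‖ ≤ ε} ≤ K * ENNReal.ofReal (ε ^ Module.finrank ℝ W) := by
  obtain ⟨g, hg⟩ := L.toLinearMap.exists_rightInverse_of_surjective (LinearMap.range_eq_top.2 hL)
  let M : W →L[ℝ] V := LinearMap.toContinuousLinearMap g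
  have hM : Function.RightInverse M L := fun w => LinearMap.congr_fun hg w
  obtain ⟨K, hK, hKle⟩ := exists_measure_tube_le κ L hL (R + ‖M‖ * (C + ‖L‖ * R))
  -- Since `det id = 1 > 1 / 2`, a map close enough to the identity at most halves volumes.
  obtain ⟨δ, hδ, hδpos⟩ : ∃ δ : NNReal, (∀ (s : Set V) (f : V → V),
      ApproximatesLinearOn f (ContinuousLinearMap.id ℝ V) s δ →
        ((1 / 2 : NNReal) : ℝ≥0∞) * κ s ≤ κ (f '' s)) ∧ 0 < δ := by
    have h := mul_le_addHaar_image_of_lt_det κ (ContinuousLinearMap.id ℝ V) (m := 1 / 2) (by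
      simp [ContinuousLinearMap.det])
    exact (h.and self_mem_nhdsWithin).exists
  have hM0 : 0 < ‖M‖ + 1 := by positivity
  have hδ' : (0 : ℝ) < δ := hδpos
  refine ⟨δ / (‖M‖ + 1), by positivity, 2 * K, by finiteness, fun T Q hQ happ ε hε hεC => ?_⟩
  -- The correction by `M` gives `L ∘ f = T`, so `f`, close to the identity, straightens the
  -- sublevel set of `T` into a tube of `L`.
  set f : V → V := fun q => q + M (T q - L q) with hf
  have hLf : ∀ q, L (f q) = T q := fun q => by simp [hf, hM (T q), hM (L q)]
  have happf : ApproximatesLinearOn f (ContinuousLinearMap.id ℝ V) {p ∈ Q | ‖T p‖ ≤ ε} δ := by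
    intro x hx y hy
    have h1 : f x - f y - (ContinuousLinearMap.id ℝ V) (x - y)
        = M (T x - T y - L (x - y)) := by
      simp only [hf, map_sub, ContinuousLinearMap.id_apply]; abel
    rw [h1]
    calc ‖M (T x - T y - L (x - y))‖ ≤ ‖M‖ * (δ / (‖M‖ + 1) * ‖x - y‖) :=
          (M.le_opNorm _).trans (by gcongr; exact happ x hx.1 y hy.1)
      _ ≤ (‖M‖ + 1) * (δ / (‖M‖ + 1) * ‖x - y‖) := by gcongr; linarith
      _ = δ * ‖x - y‖ := by field_simp
  have himg : f '' {p ∈ Q | ‖T p‖ ≤ ε} ⊆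
      {z | z ∈ closedBall 0 (R + ‖M‖ * (C + ‖L‖ * R)) ∧ ‖L z‖ ≤ ε} := by
    rintro _ ⟨q, hq, rfl⟩
    refine ⟨?_, by rw [hLf]; exact hq.2⟩
    have hqR : ‖q‖ ≤ R := by simpa using hQ hq.1
    rw [mem_closedBall_zero_iff]
    refine (norm_add_le _ _).trans (add_le_add hqR ((M.le_opNorm _).trans ?_))
    gcongr
    refine (norm_sub_le _ _).trans (add_le_add (hq.2.trans hεC) ((L.le_opNorm _).trans ?_))
    gcongr
  have h2 := (hδ _ f happf).trans ((measure_mono himg).trans (hKle ε hε))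
  have h3 : (2 : ℝ≥0∞) * ((1 / 2 : NNReal) : ℝ≥0∞) = 1 := by
    rw [show (2 : ℝ≥0∞) = ((2 : NNReal) : ℝ≥0∞) by rfl, ← ENNReal.coe_mul]; simp
  calc κ {p ∈ Q | ‖T p‖ ≤ ε} = 2 * (((1 / 2 : NNReal) : ℝ≥0∞) * κ {p ∈ Q | ‖T p‖ ≤ ε}) := by
        rw [← mul_assoc, h3, one_mul]
    _ ≤ 2 * (K * ENNReal.ofReal (ε ^ Module.finrank ℝ W)) := by gcongr
    _ = _ := by ring

open Filter Topology Metric in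
/-- The bound of `exists_measure_sublevel_le` is uniform on compact sets of surjective maps. -/
theorem exists_measure_sublevel_le_of_isCompact {V W : Type*}
    [NormedAddCommGroup V] [NormedSpace ℝ V] [FiniteDimensional ℝ V] [MeasurableSpace V]
    [BorelSpace V] [NormedAddCommGroup W] [NormedSpace ℝ W] [FiniteDimensional ℝ W]
    (κ : Measure V) [κ.IsAddHaarMeasure] {s : Set (V →L[ℝ] W)} (hs : IsCompact s)
    (hsurj : ∀ L ∈ s, Function.Surjective L) (R C : ℝ) :
    ∃ η : ℝ, 0 < η ∧ ∃ K : ℝ≥0∞, K ≠ ∞ ∧ ∀ L ∈ s, ∀ T : V → W, ∀ Q ⊆ closedBall (0 : V) R,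
      (∀ x ∈ Q, ∀ y ∈ Q, ‖T x - T y - L (x - y)‖ ≤ η * ‖x - y‖) → ∀ ε : ℝ, 0 < ε → ε ≤ C →
      κ {p ∈ Q | ‖T p‖ ≤ ε} ≤ K * ENNReal.ofReal (ε ^ Module.finrank ℝ W) := by
  refine hs.induction_on (p := fun s => ∃ η : ℝ, 0 < η ∧ ∃ K : ℝ≥0∞, K ≠ ∞ ∧ ∀ L ∈ s,
    ∀ T : V → W, ∀ Q ⊆ closedBall (0 : V) R,
    (∀ x ∈ Q, ∀ y ∈ Q, ‖T x - T y - L (x - y)‖ ≤ η * ‖x - y‖) → ∀ ε : ℝ, 0 < ε → ε ≤ C →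
    κ {p ∈ Q | ‖T p‖ ≤ ε} ≤ K * ENNReal.ofReal (ε ^ Module.finrank ℝ W)) ?_ ?_ ?_ ?_
  · exact ⟨1, one_pos, 0, by simp, by simp⟩
  · rintro s t hst ⟨η, hη, K, hK, h⟩
    exact ⟨η, hη, K, hK, fun L hL => h L (hst hL)⟩
  · rintro s t ⟨η, hη, K, hK, h⟩ ⟨η', hη', K', hK', h'⟩
    refine ⟨min η η', lt_min hη hη', max K K', by simp [hK, hK'], ?_⟩
    rintro L (hL | hL) T Q hQ happ ε hε hεC
    · refine (h L hL T Q hQ (fun x hx y hy => (happ x hx y hy).trans ?_) ε hε hεC).trans ?_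
      · gcongr; exact min_le_left _ _
      · gcongr; exact le_max_left _ _
    · refine (h' L hL T Q hQ (fun x hx y hy => (happ x hx y hy).trans ?_) ε hε hεC).trans ?_
      · gcongr; exact min_le_right _ _
      · gcongr; exact le_max_right _ _
  · intro L₀ hL₀
    obtain ⟨η, hη, K, hK, h⟩ := exists_measure_sublevel_le κ L₀ (hsurj L₀ hL₀) R C
    refine ⟨ball L₀ (η / 2), mem_nhdsWithin_of_mem_nhds (ball_mem_nhds _ (half_pos hη)),
      η / 2, half_pos hη, K, hK, fun L hL T Q hQ happ => h T Q hQ fun x hx y hy => ?_⟩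
    rw [mem_ball, dist_eq_norm] at hL
    calc ‖T x - T y - L₀ (x - y)‖ = ‖(T x - T y - L (x - y)) + (L - L₀) (x - y)‖ := by
          simp only [sub_apply]; congr 1; abel
      _ ≤ η / 2 * ‖x - y‖ + η / 2 * ‖x - y‖ :=
          (norm_add_le _ _).trans (add_le_add (happ x hx y hy)
            (((L - L₀).le_opNorm _).trans (by gcongr)))
      _ = η * ‖x - y‖ := by ring

/-! ### The Jacobian -/

theorem continuous_jacobian (l m : ℕ) : Continuous (jacobian (l := l) (m := m)) := by
  unfold jacobian
  refine Real.continuous_sqrt.comp (ContinuousLinearMap.continuous_det.comp ?_)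
  exact continuous_id.clm_comp (ContinuousLinearMap.adjoint
    (𝕜 := ℝ) (E := EuclideanSpace ℝ (Fin l)) (F := EuclideanSpace ℝ (Fin m))).continuous

/-- Positivity of `m` matters: on a zero-dimensional space the determinant is `1`. -/
theorem jacobian_zero {l m : ℕ} (hm : 0 < m) :
    jacobian (0 : EuclideanSpace ℝ (Fin l) →L[ℝ] EuclideanSpace ℝ (Fin m)) = 0 := by
  unfold jacobian
  have : Nonempty (Fin m) := ⟨⟨0, hm⟩⟩
  simp [ContinuousLinearMap.det]

theorem surjective_of_jacobian_ne_zero {l m : ℕ}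
    {L : EuclideanSpace ℝ (Fin l) →L[ℝ] EuclideanSpace ℝ (Fin m)} (hL : jacobian L ≠ 0) :
    Function.Surjective L := by
  have hdet : (L.comp (ContinuousLinearMap.adjoint L)).det ≠ 0 := by
    intro h
    exact hL (by rw [jacobian, h, Real.sqrt_zero])
  have hunit := LinearMap.isUnit_iff_ker_eq_bot _ |>.1 ((LinearMap.isUnit_iff_isUnit_det _).2 hdet.isUnit)
  intro w
  obtain ⟨v, hv⟩ := LinearMap.range_eq_top.1 (LinearMap.ker_eq_bot_iff_range_eq_top.1 hunit) w
  exact ⟨ContinuousLinearMap.adjoint L v, hv⟩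

/-! ### Consequences of transversality -/

section diffQuot

variable {X : Type*} [MetricSpace X] {l m : ℕ} {Λ : Set (EuclideanSpace ℝ (Fin l))}
  {F : X → EuclideanSpace ℝ (Fin l) → EuclideanSpace ℝ (Fin m)}

namespace IsTransversalFamily

theorem contDiffOn_diffQuot (hF : IsTransversalFamily Λ F) (x x' : X) :
    ContDiffOn ℝ 2 (diffQuot F x x') Λ :=
  ((hF.contDiffOn x).sub (hF.contDiffOn x')).const_smul _

theorem fderiv_diffQuot (hF : IsTransversalFamily Λ F) (hΛ : IsOpen Λ) (x x' : X)
    {p : EuclideanSpace ℝ (Fin l)} (hp : p ∈ Λ) :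
    fderiv ℝ (diffQuot F x x') p = (dist x x')⁻¹ • (fderiv ℝ (F x) p - fderiv ℝ (F x') p) := by
  have h : ∀ y, DifferentiableAt ℝ (F y) p := fun y =>
    ((hF.contDiffOn y).differentiableOn (by norm_num)).differentiableAt (hΛ.mem_nhds hp)
  have h1 := (((h x).hasFDerivAt.sub (h x').hasFDerivAt).const_smul (dist x x')⁻¹)
  exact h1.fderiv

theorem norm_diffQuot (x x' : X) (p : EuclideanSpace ℝ (Fin l)) :
    ‖diffQuot F x x' p‖ = (dist x x')⁻¹ * ‖F x p - F x' p‖ := by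
  rw [diffQuot, norm_smul, Real.norm_of_nonneg (by positivity)]

/-- For a transversal family, `x ↦ (F_p(x), D_p F_p(x))` expands distances up to a constant, so
that the space `X` is separable. -/
theorem separableSpace (hF : IsTransversalFamily Λ F) (hm : 0 < m) (hΛ : IsOpen Λ)
    (hne : Λ.Nonempty) : TopologicalSpace.SeparableSpace X := by
  obtain ⟨p, hp⟩ := hne
  obtain ⟨C, hC, hT⟩ := hF.transversal
  obtain ⟨c, hc, hJ⟩ := Metric.continuousAt_iff.1
    ((continuous_jacobian l m).continuousAt (x := 0)) C hC
  -- Either the difference quotient exceeds `C`, or its Jacobian is at least `C` and its derivative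
  -- stays away from `0`. Hence `Φ` has a Lipschitz inverse on its range, which is separable.
  let Φ : X → EuclideanSpace ℝ (Fin m) ×
    (EuclideanSpace ℝ (Fin l) →L[ℝ] EuclideanSpace ℝ (Fin m)) := fun x => (F x p, fderiv ℝ (F x) p)
  set b := min c C
  have hb : 0 < b := lt_min hc hC
  have hΦ : AntilipschitzWith (b⁻¹).toNNReal Φ := by
    refine AntilipschitzWith.of_le_mul_dist fun x x' => ?_
    rw [Real.coe_toNNReal _ (by positivity), inv_mul_eq_div, le_div_iff₀ hb]
    rcases eq_or_ne x x' with rfl | hx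
    · simp
    have hd : 0 < dist x x' := dist_pos.2 hx
    rw [Prod.dist_eq, dist_eq_norm, dist_eq_norm]
    by_cases h : ‖diffQuot F x x' p‖ ≤ C
    · have h1 := hT p hp x x' hx h
      have h2 : c ≤ ‖fderiv ℝ (diffQuot F x x') p‖ := by
        by_contra! hlt
        have := hJ (x := fderiv ℝ (diffQuot F x x') p) (by simpa using hlt)
        rw [jacobian_zero hm, dist_zero_right, Real.norm_eq_abs] at this
        linarith
      rw [hF.fderiv_diffQuot hΛ x x' hp, norm_smul, Real.norm_of_nonneg (by positivity),
        inv_mul_eq_div, le_div_iff₀ hd] at h2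
      calc dist x x' * b ≤ c * dist x x' := by
            rw [mul_comm]; gcongr; exact min_le_left _ _
        _ ≤ _ := h2.trans (le_max_right _ _)
    · push Not at h
      rw [norm_diffQuot, inv_mul_eq_div, lt_div_iff₀ hd] at h
      calc dist x x' * b ≤ C * dist x x' := by
            rw [mul_comm]; gcongr; exact min_le_right _ _
        _ ≤ _ := h.le.trans (le_max_left _ _)
  have hΦ' : AntilipschitzWith (b⁻¹).toNNReal (rangeFactorization Φ) := fun x x' => hΦ x x'
  have hinv := Function.rightInverse_surjInv (rangeFactorization_surjective (f := Φ))
  have hinj : Function.Injective (rangeFactorization Φ) := hΦ'.injective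
  refine (Function.Surjective.denseRange fun x =>
    ⟨rangeFactorization Φ x, ?_⟩).separableSpace (hΦ'.to_rightInverse hinv).continuous
  exact hinj (hinv _)

/-- Near every parameter, the set of parameters for which `F_p(x)` and `F_p(x')` are `δ`-close has
measure `O((δ / dist x x') ^ m)`. -/
theorem exists_volume_close_le (hF : IsTransversalFamily Λ F) (hΛ : IsOpen Λ)
    (hbdd : Bornology.IsBounded Λ) :
    ∃ C > 0, ∃ K : ℝ≥0∞, K ≠ ∞ ∧ ∀ p₀ ∈ Λ, ∃ ρ > 0, Metric.ball p₀ ρ ⊆ Λ ∧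
      ∀ x x' : X, x ≠ x' → ∀ ε : ℝ, 0 < ε → ε ≤ C →
      volume {p ∈ Metric.ball p₀ ρ | ‖diffQuot F x x' p‖ ≤ ε} ≤ K * ENNReal.ofReal (ε ^ m) := by
  obtain ⟨C, hC, hT⟩ := hF.transversal
  obtain ⟨C₂, hC₂, hD⟩ := hF.bounded_diffQuot
  obtain ⟨R, hR⟩ := hbdd.subset_closedBall 0
  -- All derivatives of difference quotients at points of transversality lie in this compact set of
  -- surjections, hence the uniform `η` and `K`.
  have hcomp : IsCompact (Metric.closedBall
      (0 : EuclideanSpace ℝ (Fin l) →L[ℝ] EuclideanSpace ℝ (Fin m)) C₂ ∩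
        {L | C ≤ |jacobian L|}) := by
    have : ProperSpace (EuclideanSpace ℝ (Fin l) →L[ℝ] EuclideanSpace ℝ (Fin m)) :=
      FiniteDimensional.proper_real _
    exact (isCompact_closedBall _ _).inter_right
      (isClosed_le continuous_const (continuous_jacobian l m).abs)
  obtain ⟨η, hη, K, hK, hvol⟩ := exists_measure_sublevel_le_of_isCompact volume hcomp
    (fun L hL => surjective_of_jacobian_ne_zero (abs_pos.1 (hC.trans_le hL.2))) R C
  refine ⟨C, hC, K, hK, fun p₀ hp₀ => ?_⟩
  obtain ⟨ρ₀, hρ₀, hball⟩ := Metric.isOpen_iff.1 hΛ p₀ hp₀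
  -- The derivative of `T` is `C₂`-Lipschitz on the ball, whose diameter is at most `2 * ρ`, so it
  -- varies by at most `η`.
  set ρ := min ρ₀ (η / (2 * C₂))
  have hsub : Metric.ball p₀ ρ ⊆ Λ := (Metric.ball_subset_ball (min_le_left _ _)).trans hball
  refine ⟨ρ, lt_min hρ₀ (by positivity), hsub, fun x x' hx ε hε hεC => ?_⟩
  set T := diffQuot F x x'
  have hTC := hF.contDiffOn_diffQuot x x'
  have hdiff : ∀ p ∈ Λ, DifferentiableAt ℝ T p := fun p hp =>
    (hTC.differentiableOn (by norm_num)).differentiableAt (hΛ.mem_nhds hp)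
  have hdiff2 : ∀ p ∈ Λ, DifferentiableAt ℝ (fderiv ℝ T) p := fun p hp =>
    ((hTC.fderiv_of_isOpen hΛ (m := 1) (by norm_num)).differentiableOn
      (by norm_num)).differentiableAt (hΛ.mem_nhds hp)
  rcases eq_empty_or_nonempty {p ∈ Metric.ball p₀ ρ | ‖T p‖ ≤ ε} with hem | ⟨p, hp, hpε⟩
  · rw [hem]; simp
  have hlip : ∀ q ∈ Metric.ball p₀ ρ, ‖fderiv ℝ T q - fderiv ℝ T p‖ ≤ η := by
    intro q hq
    have h1 := (convex_ball p₀ ρ).norm_image_sub_le_of_norm_fderiv_le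
      (fun z hz => hdiff2 z (hsub hz)) (C := C₂) (fun z hz => by
        have := (hD z (hsub hz) x x' hx).2
        rwa [← norm_iteratedFDeriv_fderiv, norm_iteratedFDeriv_one] at this) hp hq
    refine h1.trans ?_
    have h2 : ‖q - p‖ ≤ 2 * ρ := by
      rw [← dist_eq_norm]
      have := dist_triangle_right q p p₀
      rw [Metric.mem_ball] at hq hp
      linarith
    calc C₂ * ‖q - p‖ ≤ C₂ * (2 * (η / (2 * C₂))) := by
          gcongr; exact h2.trans (by gcongr; exact min_le_right _ _)
      _ = η := by field_simp
  have hmem : fderiv ℝ T p ∈ Metric.closedBall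
      (0 : EuclideanSpace ℝ (Fin l) →L[ℝ] EuclideanSpace ℝ (Fin m)) C₂ ∩
        {L | C ≤ |jacobian L|} := by
    refine ⟨?_, hT p (hsub hp) x x' hx (hpε.trans hεC)⟩
    have := (hD p (hsub hp) x x' hx).1
    rwa [norm_iteratedFDeriv_one, ← mem_closedBall_zero_iff] at this
  have := hvol _ hmem T (Metric.ball p₀ ρ) (hsub.trans hR) (fun y hy z hz =>
    (convex_ball p₀ ρ).norm_image_sub_le_of_norm_fderiv_le' (fun w hw => hdiff w (hsub hw))
      hlip hz hy) ε hε hεC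
  simpa using this

end IsTransversalFamily

end diffQuot

/-! ### Densities of singular measures -/

open Filter Topology Metric in
/-- A measure which is singular with respect to a Haar measure has infinite density almost
everywhere. -/
theorem ae_tendsto_div_addHaar_of_mutuallySingular {W : Type*} [NormedAddCommGroup W]
    [NormedSpace ℝ W] [FiniteDimensional ℝ W] [MeasurableSpace W] [BorelSpace W]
    {κ ν : Measure W} [κ.IsAddHaarMeasure] [IsFiniteMeasure ν] (h : ν ⟂ₘ κ) :
    ∀ᵐ y ∂ν, Tendsto (fun δ => ν (closedBall y δ) / κ (closedBall y δ)) (𝓝[>] 0) (𝓝 ∞) := by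
  -- Differentiate `κ` with respect to `ν`: the ratio tends to `0` at `ν`-a.e. point, and is then
  -- inverted.
  filter_upwards [Besicovitch.ae_tendsto_rnDeriv κ ν, h.symm.rnDeriv_ae_eq_zero] with y hy hy0
  rw [hy0, Pi.zero_apply] at hy
  have h1 := hy.inv
  rw [ENNReal.inv_zero] at h1
  refine h1.congr' ?_
  filter_upwards [self_mem_nhdsWithin] with δ hδ
  exact ENNReal.inv_div (Or.inl (measure_ne_top _ _))
    (Or.inr (measure_closedBall_pos κ y hδ).ne')

theorem mutuallySingular_of_acPart_eq_zero {m : ℕ} {ν : Measure (EuclideanSpace ℝ (Fin m))}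
    [IsFiniteMeasure ν] [(Measure.hausdorffMeasure (m : ℝ) :
      Measure (EuclideanSpace ℝ (Fin m))).IsAddHaarMeasure] (h : acPart ν = 0) :
    ν ⟂ₘ Measure.hausdorffMeasure (m : ℝ) :=
  (Measure.withDensity_rnDeriv_eq_zero _ _).1 h

/-! ### Separation of the images of distant sets -/

namespace IsTransversalFamily

variable {X : Type*} [MetricSpace X] {l m : ℕ} {Λ : Set (EuclideanSpace ℝ (Fin l))}
  {F : X → EuclideanSpace ℝ (Fin l) → EuclideanSpace ℝ (Fin m)}

theorem continuous_apply (hF : IsTransversalFamily Λ F) {p : EuclideanSpace ℝ (Fin l)}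
    (hp : p ∈ Λ) : Continuous fun x => F x p :=
  hF.continuousOn.comp_continuous (f := fun x => (x, p)) (by fun_prop)
    fun _ => ⟨mem_univ _, hp⟩

/-- Provides the joint measurability required by Fubini. -/
theorem isOpen_close (hF : IsTransversalFamily Λ F) {Q : Set (EuclideanSpace ℝ (Fin l))}
    (hQ : IsOpen Q) (hQΛ : Q ⊆ Λ) (δ : ℝ) :
    IsOpen {z : (EuclideanSpace ℝ (Fin l) × X) × X |
      z.1.1 ∈ Q ∧ dist (F z.1.2 z.1.1) (F z.2 z.1.1) < δ} := by
  have hopen : IsOpen {z : (EuclideanSpace ℝ (Fin l) × X) × X | z.1.1 ∈ Q} :=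
    hQ.preimage (by fun_prop)
  have hcont : ContinuousOn (fun z : (EuclideanSpace ℝ (Fin l) × X) × X =>
      dist (F z.1.2 z.1.1) (F z.2 z.1.1)) {z | z.1.1 ∈ Q} := by
    refine continuous_dist.comp_continuousOn (ContinuousOn.prodMk ?_ ?_)
    · exact hF.continuousOn.comp (f := fun z : (EuclideanSpace ℝ (Fin l) × X) × X =>
        (z.1.2, z.1.1)) (by fun_prop) fun z hz => ⟨mem_univ _, hQΛ hz⟩
    · exact hF.continuousOn.comp (f := fun z : (EuclideanSpace ℝ (Fin l) × X) × X =>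
        (z.2, z.1.1)) (by fun_prop) fun z hz => ⟨mem_univ _, hQΛ hz⟩
  exact hcont.isOpen_inter_preimage hopen isOpen_Iio

variable [MeasurableSpace X] [BorelSpace X] [SecondCountableTopology X]

/-- If `A` and `B` are at positive distance then, for almost every parameter `p` near `p₀`, the
image of `μ` restricted to `B` has finite lower density along the image of almost every point of
`A`. -/
theorem exists_ae_liminf_lt_top (hF : IsTransversalFamily Λ F) (hΛ : IsOpen Λ)
    (hbdd : Bornology.IsBounded Λ) (μ : Measure X) [IsFiniteMeasure μ] {A B : Set X}
    {r : ℝ} (hr : 0 < r)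
    (hAB : ∀ x ∈ A, ∀ x' ∈ B, r ≤ dist x x') :
    ∃ C > 0, ∀ p₀ ∈ Λ, ∃ ρ > 0, Metric.ball p₀ ρ ⊆ Λ ∧
      ∀ᵐ p ∂(volume.restrict (Metric.ball p₀ ρ)), ∀ᵐ x ∂(μ.restrict A),
        Filter.liminf (fun n : ℕ => (ENNReal.ofReal ((C / (n + 1)) ^ m))⁻¹ *
          μ.restrict B {x' | dist (F x p) (F x' p) < r * (C / (n + 1))}) Filter.atTop < ∞ := by
  obtain ⟨C, hC, K, hK, hvol⟩ := hF.exists_volume_close_le hΛ hbdd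
  refine ⟨C, hC, fun p₀ hp₀ => ?_⟩
  obtain ⟨ρ, hρ, hsub, hle⟩ := hvol p₀ hp₀
  refine ⟨ρ, hρ, hsub, ?_⟩
  set Q := Metric.ball p₀ ρ
  let ε : ℕ → ℝ := fun n => C / (n + 1)
  have hε : ∀ n, 0 < ε n := fun n => by positivity
  have hεC : ∀ n, ε n ≤ C := fun n => div_le_self hC.le (by linarith [n.cast_nonneg (α := ℝ)])
  let Z : ℕ → Set ((EuclideanSpace ℝ (Fin l) × X) × X) := fun n =>
    {z | z.1.1 ∈ Q ∧ dist (F z.1.2 z.1.1) (F z.2 z.1.1) < r * ε n}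
  have hZ : ∀ n, MeasurableSet (Z n) := fun n =>
    (hF.isOpen_close Metric.isOpen_ball hsub _).measurableSet
  let g : ℕ → EuclideanSpace ℝ (Fin l) × X → ℝ≥0∞ := fun n z =>
    (ENNReal.ofReal (ε n ^ m))⁻¹ * μ.restrict B (Prod.mk z ⁻¹' Z n)
  have hg : ∀ n, Measurable (g n) := fun n => (measurable_measure_prodMk_left (hZ n)).const_mul _
  have hε0 : ∀ n, ENNReal.ofReal (ε n ^ m) ≠ 0 := fun n => by
    have := pow_pos (hε n) m
    simpa using this
  have hsection : ∀ n, ∀ x ∈ A,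
      ∫⁻ p in Q, μ.restrict B (Prod.mk (p, x) ⁻¹' Z n) ≤
        K * ENNReal.ofReal (ε n ^ m) * μ univ := by
    intro n x hx
    have hm' : MeasurableSet ((fun q : EuclideanSpace ℝ (Fin l) × X => ((q.1, x), q.2)) ⁻¹' Z n) :=
      (by fun_prop : Measurable fun q : EuclideanSpace ℝ (Fin l) × X => ((q.1, x), q.2)) (hZ n)
    calc ∫⁻ p in Q, μ.restrict B (Prod.mk (p, x) ⁻¹' Z n)
        = ((volume.restrict Q).prod (μ.restrict B))
            ((fun q : EuclideanSpace ℝ (Fin l) × X => ((q.1, x), q.2)) ⁻¹' Z n) :=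
          (Measure.prod_apply hm').symm
      _ = ∫⁻ x' in B, volume.restrict Q {p | ((p, x), x') ∈ Z n} ∂μ :=
          Measure.prod_apply_symm hm'
      _ ≤ ∫⁻ _ in B, K * ENNReal.ofReal (ε n ^ m) ∂μ := by
          refine setLIntegral_mono measurable_const fun x' hx' => ?_
          have hd := hAB x hx x' hx'
          refine (Measure.restrict_apply_le _ _).trans ((measure_mono fun p hp => ?_).trans
            (hle x x' (dist_pos.1 (hr.trans_le hd)) (ε n) (hε n) (hεC n)))
          refine ⟨hp.1, ?_⟩
          -- As `r ≤ dist x x'`, images closer than `r * ε n` have difference quotient at most `ε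
          -- n`.
          rw [norm_diffQuot, ← dist_eq_norm, inv_mul_eq_div, div_le_iff₀ (hr.trans_le hd), mul_comm]
          exact hp.2.le.trans (by have := (hε n).le; gcongr)
      _ ≤ K * ENNReal.ofReal (ε n ^ m) * μ univ := by
          rw [lintegral_const, Measure.restrict_apply_univ]
          gcongr
          exact subset_univ _
  have hint : ∀ n, ∫⁻ z, g n z ∂((volume.restrict Q).prod (μ.restrict A)) ≤ K * μ univ * μ univ := by
    intro n
    calc ∫⁻ z, g n z ∂((volume.restrict Q).prod (μ.restrict A))
        = ∫⁻ x in A, (∫⁻ p in Q, g n (p, x)) ∂μ := lintegral_prod_symm' _ (hg n)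
      _ ≤ ∫⁻ _ in A, K * μ univ ∂μ := by
          refine setLIntegral_mono measurable_const fun x hx => ?_
          simp only [g]
          rw [lintegral_const_mul' _ _ (ENNReal.inv_ne_top.2 (hε0 n))]
          calc _ ≤ (ENNReal.ofReal (ε n ^ m))⁻¹ * (K * ENNReal.ofReal (ε n ^ m) * μ univ) := by
                gcongr; exact hsection n x hx
            _ = (ENNReal.ofReal (ε n ^ m))⁻¹ * ENNReal.ofReal (ε n ^ m) * (K * μ univ) := by ring
            _ = K * μ univ := by
                rw [ENNReal.inv_mul_cancel (hε0 n) ENNReal.ofReal_ne_top, one_mul]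
      _ ≤ K * μ univ * μ univ := by
          rw [lintegral_const, Measure.restrict_apply_univ]
          gcongr
          exact subset_univ _
  -- Fatou: the bound on the integrals of `g n` does not depend on `n`.
  have hfin : ∫⁻ z, Filter.liminf (fun n => g n z) Filter.atTop
      ∂((volume.restrict Q).prod (μ.restrict A)) ≠ ∞ := by
    refine ne_top_of_le_ne_top (b := K * μ univ * μ univ) (by finiteness) ?_
    refine (lintegral_liminf_le hg).trans ?_
    exact Filter.liminf_le_of_le (by isBoundedDefault) fun b hb =>
      let ⟨n, hn⟩ := hb.exists; hn.trans (hint n)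
  have hae := Measure.ae_ae_of_ae_prod (ae_lt_top (Measurable.liminf hg) hfin)
  filter_upwards [hae, ae_restrict_mem Metric.isOpen_ball.measurableSet] with p hp hpQ
  filter_upwards [hp] with x hx
  have hset : ∀ n, Prod.mk (p, x) ⁻¹' Z n = {x' | dist (F x p) (F x' p) < r * ε n} := fun n => by
    ext x'; exact ⟨fun h => h.2, fun h => ⟨hpQ, h⟩⟩
  simpa only [g, hset] using hx

open Filter Topology Metric in
/-- If `A` and `B` are at positive distance then, for almost every parameter `p` for which the
image of `μ` is singular, the images of `μ` restricted to `A` and to `B` are carried by disjoint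
sets. -/
theorem ae_exists_separating (hF : IsTransversalFamily Λ F) (hΛ : IsOpen Λ)
    (hbdd : Bornology.IsBounded Λ) (μ : Measure X) [IsFiniteMeasure μ] {A B : Set X}
    {r : ℝ} (hr : 0 < r)
    (hAB : ∀ x ∈ A, ∀ x' ∈ B, r ≤ dist x x') :
    ∀ᵐ p ∂(volume.restrict Λ), acPart (μ.map fun x => F x p) = 0 →
      ∃ D : Set (EuclideanSpace ℝ (Fin m)),
        μ.restrict A {x | F x p ∈ D} = 0 ∧ μ.restrict B {x | F x p ∉ D} = 0 := by
  obtain ⟨C, hC, hloc⟩ := hF.exists_ae_liminf_lt_top hΛ hbdd μ hr hAB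
  let κ : Measure (EuclideanSpace ℝ (Fin m)) := Measure.hausdorffMeasure (m : ℝ)
  have hκ : κ.IsAddHaarMeasure := by
    simpa using isAddHaarMeasure_hausdorffMeasure (E := EuclideanSpace ℝ (Fin m))
  rw [ae_restrict_iff' hΛ.measurableSet, ae_iff]
  refine measure_null_of_locally_null _ fun p₀ hp₀ => ?_
  obtain ⟨ρ, hρ, hsub, hae⟩ := hloc p₀ (by simp only [mem_ofPred_eq] at hp₀; tauto)
  refine ⟨_ ∩ ball p₀ ρ, inter_mem_nhdsWithin _ (ball_mem_nhds p₀ hρ), ?_⟩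
  rw [ae_restrict_iff' measurableSet_ball, ae_iff] at hae
  refine measure_mono_null (fun p hp => ?_) hae
  obtain ⟨hbad, hpQ⟩ := hp
  simp only [mem_ofPred_eq] at hbad ⊢
  intro hgood
  refine hbad fun hpΛ hac => ?_
  have hmeas : Measurable fun x => F x p := (hF.continuous_apply hpΛ).measurable
  set ν := (μ.restrict B).map fun x => F x p
  have hν : ν ⟂ₘ κ := (mutuallySingular_of_acPart_eq_zero hac).mono
    (Measure.map_mono Measure.restrict_le_self hmeas) le_rfl
  -- The infinite-density points of `ν` carry `ν`; a point of `A` mapped there would have infinite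
  -- liminf.
  refine ⟨{y | Tendsto (fun δ => ν (closedBall y δ) / κ (closedBall y δ)) (𝓝[>] 0) (𝓝 ∞)},
    ?_, ae_of_ae_map hmeas.aemeasurable (ae_tendsto_div_addHaar_of_mutuallySingular hν)⟩
  refine measure_mono_null ?_ (hgood hpQ)
  intro x hx hfin
  rw [mem_ofPred_eq] at hfin
  refine hfin.ne (Tendsto.liminf_eq ?_)
  let ε : ℕ → ℝ := fun n => C / (n + 1)
  have hε : ∀ n, 0 < ε n := fun n => by positivity
  -- Halving the radius puts the closed ball inside the strict sublevel set.
  have hδ : Tendsto (fun n => r * ε n / 2) atTop (𝓝[>] 0) := by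
    refine tendsto_nhdsWithin_iff.2 ⟨?_, Eventually.of_forall fun n => by
      have := hε n; simp only [mem_Ioi]; positivity⟩
    have : Tendsto ε atTop (𝓝 0) := tendsto_const_div_atTop_nhds_zero_nat C |>.comp
      (tendsto_add_atTop_nat 1) |>.congr fun n => by simp [ε]
    simpa using (this.const_mul r).div_const 2
  have hk0 : ENNReal.ofReal ((r / 2) ^ m) * κ (ball 0 1) ≠ 0 :=
    mul_ne_zero (by simpa using pow_pos (half_pos hr) m) (measure_ball_pos κ 0 one_pos).ne'
  have hlim := ENNReal.Tendsto.mul_const (b := ENNReal.ofReal ((r / 2) ^ m) * κ (ball 0 1))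
    (hx.comp hδ) (Or.inl ENNReal.top_ne_zero)
  rw [ENNReal.top_mul hk0] at hlim
  refine tendsto_nhds_top_mono hlim (Eventually.of_forall fun n => ?_)
  have hκb : κ (closedBall (F x p) (r * ε n / 2)) =
      ENNReal.ofReal (ε n ^ m) * (ENNReal.ofReal ((r / 2) ^ m) * κ (ball 0 1)) := by
    rw [Measure.addHaar_closedBall _ _ (by have := hε n; positivity), finrank_euclideanSpace_fin,
      ← mul_assoc, ← ENNReal.ofReal_mul (by have := hε n; positivity), ← mul_pow]
    congr 3; ring
  have hε0 : ENNReal.ofReal (ε n ^ m) ≠ 0 := by simpa using pow_pos (hε n) m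
  have hk1 : ENNReal.ofReal ((r / 2) ^ m) * κ (ball 0 1) ≠ ∞ :=
    ENNReal.mul_ne_top ENNReal.ofReal_ne_top measure_ball_lt_top.ne
  simp only [Function.comp_apply]
  rw [hκb, div_eq_mul_inv, ENNReal.mul_inv (Or.inl hε0) (Or.inl ENNReal.ofReal_ne_top), mul_assoc,
    mul_assoc, ENNReal.inv_mul_cancel hk0 hk1, mul_one, mul_comm,
    Measure.map_apply hmeas measurableSet_closedBall]
  gcongr
  intro x' hx'
  have h1 : dist (F x' p) (F x p) ≤ r * ε n / 2 := hx'
  have h2 : 0 < r * ε n := mul_pos hr (hε n)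
  rw [dist_comm] at h1
  exact h1.trans_lt (by linarith)

end IsTransversalFamily

/-! ### Injectivity from countably many separations -/

theorem theoremp {X : Type*} [MetricSpace X] [LocallyCompactSpace X]
    [MeasurableSpace X] [BorelSpace X]
    (l m : ℕ) (hm : 0 < m) (hml : m ≤ l)
    (Λ : Set (EuclideanSpace ℝ (Fin l))) (hΛ_open : IsOpen Λ)
    (hΛ_bdd : Bornology.IsBounded Λ)
    (F : X → EuclideanSpace ℝ (Fin l) → EuclideanSpace ℝ (Fin m))
    (hF : IsTransversalFamily Λ F)
    (μ : Measure X) [IsFiniteMeasure μ]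
    (S : Set (EuclideanSpace ℝ (Fin l))) (hS : MeasurableSet S) (hSΛ : S ⊆ Λ) :
    (∀ᵐ p ∂(volume.restrict S), ∃ E : Set X,
        MeasurableSet E ∧ μ Eᶜ = 0 ∧ InjOn (fun x => F x p) E) ∨
      0 < volume {p ∈ S | acPart (μ.map (fun x => F x p)) ≠ 0} := by
  rcases Λ.eq_empty_or_nonempty with rfl | hne
  · left
    simp [subset_empty_iff.1 hSΛ]
  have := hF.separableSpace hm hΛ_open hne
  have := UniformSpace.secondCountable_of_separable X
  refine or_iff_not_imp_right.2 fun hsing => ?_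
  rw [not_lt, nonpos_iff_eq_zero] at hsing
  have hac : ∀ᵐ p ∂(volume.restrict S), acPart (μ.map fun x => F x p) = 0 := by
    rw [ae_restrict_iff' hS, ae_iff]
    simpa only [Classical.not_imp] using hsing
  obtain ⟨s, hs, hdense⟩ := TopologicalSpace.exists_countable_dense X
  have : Countable s := hs.to_subtype
  -- Centres three radii apart leave the two balls at distance at least one radius.
  have hsep : ∀ᵐ p ∂(volume.restrict S), ∀ c c' : s, ∀ n : ℕ,
      3 * (1 / ((n : ℝ) + 1)) ≤ dist (c : X) c' → ∃ D : Set (EuclideanSpace ℝ (Fin m)),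
        μ.restrict (Metric.ball (c : X) (1 / ((n : ℝ) + 1))) {x | F x p ∈ D} = 0 ∧
        μ.restrict (Metric.ball (c' : X) (1 / ((n : ℝ) + 1))) {x | F x p ∉ D} = 0 := by
    simp only [ae_all_iff]
    intro c c' n hcc
    have hae := hF.ae_exists_separating hΛ_open hΛ_bdd μ
      (A := Metric.ball (c : X) (1 / ((n : ℝ) + 1))) (B := Metric.ball (c' : X) (1 / ((n : ℝ) + 1)))
      (r := 1 / ((n : ℝ) + 1)) (by positivity) (by
        intro x hx x' hx'
        rw [Metric.mem_ball] at hx hx'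
        have := dist_triangle4_right (c : X) c' x x'
        rw [dist_comm (c : X) x, dist_comm (c' : X) x'] at this
        linarith)
    filter_upwards [ae_restrict_of_ae_restrict_of_subset hSΛ hae, hac] with p hp hp'
    exact hp hp'
  filter_upwards [hsep] with p hp
  choose D hDA hDB using hp
  let N : Set X := ⋃ (c : s) (c' : s) (n : ℕ) (h : 3 * (1 / ((n : ℝ) + 1)) ≤ dist (c : X) c'),
    ({x | F x p ∈ D c c' n h} ∩ Metric.ball (c : X) (1 / ((n : ℝ) + 1))) ∪
    ({x | F x p ∉ D c c' n h} ∩ Metric.ball (c' : X) (1 / ((n : ℝ) + 1)))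
  have hN : μ N = 0 := by
    simp only [N, measure_iUnion_null_iff]
    intro c c' n h
    refine measure_union_null ?_ ?_
    · rw [← Measure.restrict_apply' measurableSet_ball]; exact hDA c c' n h
    · rw [← Measure.restrict_apply' measurableSet_ball]; exact hDB c c' n h
  -- The sets `D` are not known to be measurable, so `N` is replaced by a measurable null hull.
  refine ⟨(toMeasurable μ N)ᶜ, (measurableSet_toMeasurable _ _).compl, by
    rw [compl_compl, measure_toMeasurable, hN], fun x hx x' hx' hxx' => ?_⟩
  by_contra hne'
  -- Five radii: three between the centres, and one for approximating each point.
  obtain ⟨n, hn⟩ := exists_nat_one_div_lt (div_pos (dist_pos.2 hne') (by norm_num : (0 : ℝ) < 5))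
  have hpos : (0 : ℝ) < 1 / ((n : ℝ) + 1) := by positivity
  obtain ⟨c, hc, hcx⟩ := hdense.exists_dist_lt x hpos
  obtain ⟨c', hc', hcx'⟩ := hdense.exists_dist_lt x' hpos
  have hcc : 3 * (1 / ((n : ℝ) + 1)) ≤ dist c c' := by
    have := dist_triangle4_right x x' c c'
    linarith
  have hxN : ∀ y ∈ (toMeasurable μ N)ᶜ, y ∉ N := fun y hy hyN => hy (subset_toMeasurable μ N hyN)
  have h1 : F x p ∉ D ⟨c, hc⟩ ⟨c', hc'⟩ n hcc := fun h => hxN x hx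
    (mem_iUnion₂.2 ⟨⟨c, hc⟩, ⟨c', hc'⟩, mem_iUnion₂.2 ⟨n, hcc, Or.inl ⟨h, hcx⟩⟩⟩)
  have h2 : F x' p ∈ D ⟨c, hc⟩ ⟨c', hc'⟩ n hcc := by
    by_contra h
    exact hxN x' hx'
      (mem_iUnion₂.2 ⟨⟨c, hc⟩, ⟨c', hc'⟩, mem_iUnion₂.2 ⟨n, hcc, Or.inr ⟨h, hcx'⟩⟩⟩)
  exact h1 (by rw [show F x p = F x' p from hxx']; exact h2)
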